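/- Let $\mathbb{M}_n=\{x=(x_0,\vec x)\in\mathbb{R}\times\mathbb{R}^n : x_0^2-\|\vec x\|^2=1,\ x_0>0\}$ be the hyperboloid model of $n$-dimensional hyperbolic space, with distance $d_H(x,y)=\operatorname{arcosh}(x_0y_0-\langle\vec x,\vec y\rangle)$ and origin $e_0=(1,0)$. For points $x_1,\dots,x_k\in\mathbb{M}_n$, a Karcher mean is a point $z\in\mathbb{M}_n$ minimizing $\sum_{i=1}^k d_H(x_i,z)^2$, and a pseudo-Euclidean mean is a point $z\in\mathbb{M}_n$ minimizing $\sum_{i=1}^k \sinh^2(d_H(x_i,z))$. A dimension-$r$ geodesic submanifold rooted at $p\in\mathbb{M}_n$ is the union of all geodesics through $p$ (constant curves allowed) whose velocity at $p$ lies in a given $r$-dimensional linear subspace $T$ of the tangent space at $p$. Let $n,k,r\ge 0$ be integers and let $(d_{i,j})_{1\le i,j\le k}$ be real numbers. Then the following are equivalent: (a) there are points $x_1,\dots,x_k\in\mathbb{M}_n$ with $d_H(x_i,x_j)=d_{i,j}$ for all $i,j$, all lying in a dimension-$r$ geodesic submanifold of $\mathbb{M}_n$ rooted at a pseudo-Euclidean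 mean of $x_1,\dots,x_k$; (b) there are points $x_1,\dots,x_k\in\mathbb{M}_n$ with $d_H(x_i,x_j)=d_{i,j}$ for all $i,j$, all lying in a dimension-$r$ geodesic submanifold of $\mathbb{M}_n$ rooted at a Karcher mean of $x_1,\dots,x_k$. The same equivalence holds if in both (a) and (b) the mean at which the submanifold is rooted is moreover required to be the origin $e_0$. -/

import Mathlib

noncomputable section

namespace HypEmbed

/-- The vector space `ℝ × ℝⁿ` containing the hyperboloid; a vector is `x = (x₀, x⃗)`. -/
abbrev Ambient (n : ℕ) : Type := ℝ × EuclideanSpace ℝ (Fin n)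

/-- The Minkowski form `xᵀ Q y = x₀ y₀ - ⟨x⃗, y⃗⟩`, as a bilinear form. -/
def minkowski (n : ℕ) : Ambient n →ₗ[ℝ] Ambient n →ₗ[ℝ] ℝ :=
  LinearMap.mk₂ ℝ (fun x y => x.1 * y.1 - inner ℝ x.2 y.2)
    (fun x x' y => by simp only [Prod.fst_add, Prod.snd_add, inner_add_left]; ring)
    (fun c x y => by
      simp only [Prod.smul_fst, Prod.smul_snd, real_inner_smul_left, smul_eq_mul]; ring)
    (fun x y y' => by simp only [Prod.fst_add, Prod.snd_add, inner_add_right]; ring)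
    (fun c x y => by
      simp only [Prod.smul_fst, Prod.smul_snd, real_inner_smul_right, smul_eq_mul]; ring)

/-- The hyperboloid model of `n`-dimensional hyperbolic space: the upper sheet
`xᵀ Q x = 1`, `x₀ > 0`. -/
abbrev Hyperboloid (n : ℕ) : Type := {x : Ambient n // minkowski n x x = 1 ∧ 0 < x.1}

variable {n : ℕ}

/-- The hyperbolic distance `d_H(x, y) = arcosh (xᵀ Q y)`. It is not the `dist` that the subtype
inherits from the ambient vector space. -/
def hdist (x y : Hyperboloid n) : ℝ := Real.arcosh (minkowski n x.1 y.1)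

/-- The origin `e₀ = (1, 0)` of the hyperboloid model. -/
def origin (n : ℕ) : Hyperboloid n := ⟨(1, 0), by simp [minkowski]⟩

/-- `z` is a Karcher mean of `x₁, …, x_k`: it minimizes the Fréchet variance
`z ↦ ∑ i, d_H(xᵢ, z)²` over hyperbolic space. -/
def IsKarcherMean {k : ℕ} (x : Fin k → Hyperboloid n) (z : Hyperboloid n) : Prop :=
  ∀ w : Hyperboloid n, ∑ i, hdist (x i) z ^ 2 ≤ ∑ i, hdist (x i) w ^ 2

/-- `z` is a pseudo-Euclidean mean of `x₁, …, x_k`: it minimizes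
`Ψ(z) = ∑ i, sinh²(d_H(xᵢ, z))` over hyperbolic space. -/
def IsPseudoEuclideanMean {k : ℕ} (x : Fin k → Hyperboloid n) (z : Hyperboloid n) : Prop :=
  ∀ w : Hyperboloid n,
    ∑ i, Real.sinh (hdist (x i) z) ^ 2 ≤ ∑ i, Real.sinh (hdist (x i) w) ^ 2

/-- The tangent space of the hyperboloid at `p`, as a linear subspace of the ambient space:
the vectors `v` with `pᵀ Q v = 0`. -/
def tangentSpace (p : Hyperboloid n) : Submodule ℝ (Ambient n) :=
  LinearMap.ker (minkowski n p.1)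

/-- A complete geodesic of hyperbolic space, parametrized with constant speed `c ≥ 0`
(with `c = 0` for a constant curve): every piece of it is a shortest path. -/
def IsGeodesic (γ : ℝ → Hyperboloid n) : Prop :=
  ∃ c : ℝ, 0 ≤ c ∧ ∀ s t : ℝ, hdist (γ s) (γ t) = c * |s - t|

/-- The union of all geodesics through `p` whose velocity at `p` lies in `T`. -/
def geodesicUnion (p : Hyperboloid n) (T : Submodule ℝ (Ambient n)) : Set (Hyperboloid n) :=
  {x | ∃ (γ : ℝ → Hyperboloid n) (v : Ambient n), IsGeodesic γ ∧ γ 0 = p ∧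
    HasDerivAt (fun t => (γ t).1) v 0 ∧ v ∈ T ∧ ∃ t : ℝ, γ t = x}

/-- `S` is a geodesic submanifold of dimension `r` rooted at `p`: the union of the geodesics
through `p` tangent to some `r`-dimensional linear subspace of the tangent space at `p`. -/
def IsRootedGeodesicSubmanifold (r : ℕ) (p : Hyperboloid n) (S : Set (Hyperboloid n)) : Prop :=
  ∃ T : Submodule ℝ (Ambient n), T ≤ tangentSpace p ∧ Module.finrank ℝ T = r ∧
    S = geodesicUnion p T

/-- The distances `d i j` are realized by points of a dimension-`r` geodesic submanifold that is
rooted at `p`, where `p` is a pseudo-Euclidean mean of these points. -/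
def EmbedsAtPseudoEuclideanMean {k : ℕ} (d : Fin k → Fin k → ℝ) (r : ℕ)
    (p : Hyperboloid n) : Prop :=
  ∃ (x : Fin k → Hyperboloid n) (S : Set (Hyperboloid n)),
    (∀ i j, hdist (x i) (x j) = d i j) ∧ IsRootedGeodesicSubmanifold r p S ∧
      (∀ i, x i ∈ S) ∧ IsPseudoEuclideanMean x p

/-- The distances `d i j` are realized by points of a dimension-`r` geodesic submanifold that is
rooted at `p`, where `p` is a Karcher mean of these points. -/
def EmbedsAtKarcherMean {k : ℕ} (d : Fin k → Fin k → ℝ) (r : ℕ) (p : Hyperboloid n) : Prop :=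
  ∃ (x : Fin k → Hyperboloid n) (S : Set (Hyperboloid n)),
    (∀ i j, hdist (x i) (x j) = d i j) ∧ IsRootedGeodesicSubmanifold r p S ∧
      (∀ i, x i ∈ S) ∧ IsKarcherMean x p

end HypEmbed

end

noncomputable section

namespace HypEmbed

open Filter

variable {n : ℕ}

/-! ### The Minkowski form -/

/-! A family of points lies in a dimension-`r` geodesic submanifold rooted at `p` exactly when it
lies in an `(r + 1)`-dimensional linear subspace `W` containing `p`
(`exists_isRootedGeodesicSubmanifold_iff`). Apart from membership, `W` does not remember the root,
so the same points lie in a submanifold rooted at any other hyperboloid point of `W`. It remains to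
find a mean of the other kind inside `W`. A global minimizer exists because the total cost is
proper; Minkowski-orthogonal projection to `W`, followed by rescaling, increases no distance to a
point of `W`, so it yields a minimizer in `W` (`IsCost.exists_isCostMean_mem`).

Only the properties in `IsCost` enter, so both directions are the same argument
(`EmbedsAtCostMean.of_isCost`). To prescribe the root, a linear isometry exchanging two given points
(`swap`) carries the new mean there. -/

theorem minkowski_apply (x y : Ambient n) :
    minkowski n x y = x.1 * y.1 - inner ℝ x.2 y.2 := rfl

theorem minkowski_comm (x y : Ambient n) : minkowski n x y = minkowski n y x := by
  rw [minkowski_apply, minkowski_apply, real_inner_comm, mul_comm]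

theorem minkowski_self (x : Ambient n) : minkowski n x x = x.1 ^ 2 - ‖x.2‖ ^ 2 := by
  rw [minkowski_apply, real_inner_self_eq_norm_sq, ← sq]

theorem continuous_minkowski (x : Ambient n) : Continuous (minkowski n x) := by
  have h : ⇑(minkowski n x) = fun y : Ambient n => x.1 * y.1 - inner ℝ x.2 y.2 := rfl
  rw [h]
  fun_prop

theorem Hyperboloid.fst_sq (x : Hyperboloid n) : x.1.1 ^ 2 = 1 + ‖x.1.2‖ ^ 2 := by
  have := x.2.1
  rw [minkowski_self] at this
  linarith

theorem Hyperboloid.norm_snd_lt_fst (x : Hyperboloid n) : ‖x.1.2‖ < x.1.1 := by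
  have h := x.fst_sq
  exact lt_of_pow_lt_pow_left₀ 2 x.2.2.le (by linarith)

/-- The reverse Cauchy-Schwarz inequality on the upper sheet. -/
theorem one_le_minkowski (x y : Hyperboloid n) : 1 ≤ minkowski n x.1 y.1 := by
  have hx := x.fst_sq
  have hy := y.fst_sq
  have hin := real_inner_le_norm x.1.2 y.1.2
  have h : 1 + ‖x.1.2‖ * ‖y.1.2‖ ≤ x.1.1 * y.1.1 := by
    refine le_of_sq_le_sq ?_ (mul_pos x.2.2 y.2.2).le
    rw [mul_pow, hx, hy]
    nlinarith [sq_nonneg (‖x.1.2‖ - ‖y.1.2‖)]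
  rw [minkowski_apply]
  linarith

/-- The form has signature `(1, n)` and `p` is timelike, so it is negative definite on the
complement of `p`. Later equalities of vectors follow by showing that their difference is null and
orthogonal to `p`. -/
theorem minkowski_self_nonpos {p : Hyperboloid n} {v : Ambient n}
    (h : minkowski n p.1 v = 0) : minkowski n v v ≤ 0 ∧ (minkowski n v v = 0 → v = 0) := by
  have hp := p.fst_sq
  have hp0 := p.2.2
  have hin := abs_real_inner_le_norm p.1.2 v.2
  rw [minkowski_apply, sub_eq_zero] at h
  rw [← h] at hin
  have hsq : (p.1.1 * v.1) ^ 2 ≤ (‖p.1.2‖ * ‖v.2‖) ^ 2 := sq_le_sq' (abs_le.1 hin).1 (abs_le.1 hin).2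
  have key : p.1.1 ^ 2 * (v.1 ^ 2 - ‖v.2‖ ^ 2) ≤ - ‖v.2‖ ^ 2 := by
    have : ‖p.1.2‖ ^ 2 = p.1.1 ^ 2 - 1 := by linarith
    rw [mul_pow, mul_pow, this] at hsq
    linarith
  have hp2 : 0 < p.1.1 ^ 2 := by positivity
  rw [minkowski_self]
  constructor
  · by_contra! hc
    have := mul_pos hp2 hc
    nlinarith [sq_nonneg ‖v.2‖]
  · intro h0
    rw [h0, mul_zero] at key
    have hv : ‖v.2‖ = 0 := by
      have : ‖v.2‖ ^ 2 = 0 := le_antisymm (by linarith) (sq_nonneg _)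
      simpa using this
    have hv1 : v.1 = 0 := by
      rw [hv] at h0
      simpa using h0
    exact Prod.ext hv1 (norm_eq_zero.1 hv)

/-- The sign of the product with `p` tells the two sheets apart. -/
theorem fst_pos_of_minkowski_pos {p : Hyperboloid n} {y : Ambient n}
    (hy : minkowski n y y = 1) (h : 0 < minkowski n p.1 y) : 0 < y.1 := by
  by_contra! hc
  rw [minkowski_self] at hy
  have h1 : ‖y.2‖ ≤ -y.1 := le_of_sq_le_sq (by nlinarith) (by linarith)
  have h2 := p.norm_snd_lt_fst
  have h3 := abs_real_inner_le_norm p.1.2 y.2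
  have h4 : ‖p.1.2‖ * ‖y.2‖ ≤ p.1.1 * -y.1 :=
    mul_le_mul h2.le h1 (norm_nonneg _) p.2.2.le
  rw [minkowski_apply] at h
  linarith [(abs_le.1 h3).1]

/-- Two points of the hyperboloid with Minkowski product `1` coincide. -/
theorem eq_of_minkowski_eq_one {x y : Hyperboloid n} (h : minkowski n x.1 y.1 = 1) : x = y := by
  have hx := x.2.1
  have hy := y.2.1
  have h' := (minkowski_comm y.1 x.1).trans h
  have h1 : minkowski n x.1 (x.1 - y.1) = 0 := by rw [map_sub, hx, h, sub_self]
  have h2 : minkowski n (x.1 - y.1) (x.1 - y.1) = 0 := by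
    simp only [map_sub, LinearMap.sub_apply, hx, hy, h, h']
    ring
  exact Subtype.ext (sub_eq_zero.1 ((minkowski_self_nonpos h1).2 h2))

theorem cosh_hdist (x y : Hyperboloid n) : Real.cosh (hdist x y) = minkowski n x.1 y.1 :=
  Real.cosh_arcosh (one_le_minkowski x y)

theorem hdist_nonneg (x y : Hyperboloid n) : 0 ≤ hdist x y :=
  Real.arcosh_nonneg (one_le_minkowski x y)

theorem hdist_le_hdist_iff {x y z w : Hyperboloid n} :
    hdist x y ≤ hdist z w ↔ minkowski n x.1 y.1 ≤ minkowski n z.1 w.1 :=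
  Real.arcosh_le_arcosh (zero_lt_one.trans_le (one_le_minkowski x y))
    (zero_lt_one.trans_le (one_le_minkowski z w))

/-! ### Geodesics -/

theorem IsGeodesic.minkowski_eq {γ : ℝ → Hyperboloid n} {c : ℝ}
    (h : ∀ s t : ℝ, hdist (γ s) (γ t) = c * |s - t|) (hc : 0 ≤ c) (s t : ℝ) :
    minkowski n (γ s).1 (γ t).1 = Real.cosh (c * (s - t)) := by
  rw [← cosh_hdist, h, ← Real.cosh_abs (c * (s - t)), abs_mul, abs_of_nonneg hc]

/-- A geodesic stays in the span of its initial point and its initial velocity. -/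
theorem IsGeodesic.mem_span_sup {γ : ℝ → Hyperboloid n} (hγ : IsGeodesic γ) {v : Ambient n}
    (hv : HasDerivAt (fun t => (γ t).1) v 0) {T : Submodule ℝ (Ambient n)} (hT : v ∈ T) (t : ℝ) :
    (γ t).1 ∈ Submodule.span ℝ {(γ 0).1} ⊔ T := by
  obtain ⟨c, hc, h⟩ := hγ
  have hm := IsGeodesic.minkowski_eq h hc
  have hp : (γ 0).1 ∈ Submodule.span ℝ {(γ 0).1} ⊔ T :=
    Submodule.mem_sup_left (Submodule.mem_span_singleton_self _)
  rcases hc.eq_or_lt with rfl | hc'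
  · have : γ 0 = γ t := eq_of_minkowski_eq_one (by rw [hm]; simp)
    rwa [← this]
  · have hs : Real.sinh c ≠ 0 := (Real.sinh_pos_iff.2 hc').ne'
    -- The only candidate for the unit direction: solve `γ 1 = cosh c • γ 0 + sinh c • u` for `u`.
    set u : Ambient n := (Real.sinh c)⁻¹ • ((γ 1).1 - Real.cosh c • (γ 0).1) with hu
    have hform : ∀ s, (γ s).1 = Real.cosh (c * s) • (γ 0).1 + Real.sinh (c * s) • u := by
      intro s
      have hpp : minkowski n (γ 0).1 (γ 0).1 = 1 := (γ 0).2.1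
      have hss : minkowski n (γ s).1 (γ s).1 = 1 := (γ s).2.1
      have h11 : minkowski n (γ 1).1 (γ 1).1 = 1 := (γ 1).2.1
      have h01 : minkowski n (γ 0).1 (γ 1).1 = Real.cosh c := by rw [hm]; simp
      have h10 : minkowski n (γ 1).1 (γ 0).1 = Real.cosh c := by rw [hm]; simp
      have h0s : minkowski n (γ 0).1 (γ s).1 = Real.cosh (c * s) := by rw [hm]; simp
      have hs0 : minkowski n (γ s).1 (γ 0).1 = Real.cosh (c * s) := by rw [hm]; simp
      have hs1 : minkowski n (γ s).1 (γ 1).1 =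
          Real.cosh (c * s) * Real.cosh c - Real.sinh (c * s) * Real.sinh c := by
        rw [hm, mul_sub, mul_one, Real.cosh_sub]
      have hpu : minkowski n (γ 0).1 u = 0 := by
        simp only [hu, map_smul, map_sub, smul_eq_mul, hpp, h01]
        ring
      have huu : minkowski n u u = -1 := by
        have : minkowski n u u = (Real.sinh c)⁻¹ ^ 2 * (1 - Real.cosh c ^ 2) := by
          simp only [hu, map_smul, map_sub, LinearMap.smul_apply, LinearMap.sub_apply,
            smul_eq_mul, hpp, h01, h10, h11]
          ring
        rw [this, Real.cosh_sq]
        field_simp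
        ring
      have hsu : minkowski n (γ s).1 u = -Real.sinh (c * s) := by
        simp only [hu, map_smul, map_sub, smul_eq_mul, hs0, hs1]
        field_simp
        ring
      have hup := (minkowski_comm u (γ 0).1).trans hpu
      have hus := (minkowski_comm u (γ s).1).trans hsu
      have h1 : minkowski n (γ 0).1
          ((γ s).1 - (Real.cosh (c * s) • (γ 0).1 + Real.sinh (c * s) • u)) = 0 := by
        simp only [map_sub, map_add, map_smul, smul_eq_mul, hpp, hpu, h0s]
        ring
      refine sub_eq_zero.1 ((minkowski_self_nonpos h1).2 ?_)
      simp only [map_sub, map_add, map_smul, LinearMap.sub_apply, LinearMap.add_apply,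
        LinearMap.smul_apply, smul_eq_mul, hpp, hpu, hup, huu, hsu, hus, h0s, hs0, hss]
      linarith [Real.cosh_sq (c * s)]
    have hcs : HasDerivAt (fun s : ℝ => c * s) c 0 := by
      simpa using (hasDerivAt_id (0 : ℝ)).const_mul c
    have hd : HasDerivAt (fun s => (γ s).1) (c • u) 0 := by
      have h1 := (hcs.cosh.smul_const (γ 0).1).add (hcs.sinh.smul_const u)
      have h2 : HasDerivAt (fun s => (γ s).1) _ 0 :=
        h1.congr_of_eventuallyEq (Eventually.of_forall hform)
      convert h2 using 1
      simp
    have hvu : v = c • u := hv.unique hd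
    have huT : u ∈ T := by
      have : u = c⁻¹ • v := by rw [hvu, smul_smul, inv_mul_cancel₀ hc'.ne', one_smul]
      rw [this]
      exact T.smul_mem _ hT
    rw [hform t]
    exact Submodule.add_mem _ (Submodule.smul_mem _ _ hp)
      (Submodule.smul_mem _ _ (Submodule.mem_sup_right huT))

/-- The unit-speed geodesic through `p` with velocity `u`. -/
def unitGeodesic (p : Hyperboloid n) (u : Ambient n) (hpu : minkowski n p.1 u = 0)
    (huu : minkowski n u u = -1) (t : ℝ) : Hyperboloid n :=
  have h1 : minkowski n (Real.cosh t • p.1 + Real.sinh t • u)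
      (Real.cosh t • p.1 + Real.sinh t • u) = 1 := by
    have hup := (minkowski_comm u p.1).trans hpu
    simp only [map_add, map_smul, LinearMap.add_apply,
      LinearMap.smul_apply, smul_eq_mul, p.2.1, hpu, hup, huu]
    linarith [Real.cosh_sq t]
  ⟨Real.cosh t • p.1 + Real.sinh t • u, h1, fst_pos_of_minkowski_pos (p := p) h1 (by
    simp only [map_add, map_smul, smul_eq_mul, p.2.1, hpu]
    linarith [Real.cosh_pos t])⟩

theorem isGeodesic_unitGeodesic (p : Hyperboloid n) (u : Ambient n)
    (hpu : minkowski n p.1 u = 0) (huu : minkowski n u u = -1) :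
    IsGeodesic (unitGeodesic p u hpu huu) := by
  refine ⟨1, zero_le_one, fun s t => ?_⟩
  have hup := (minkowski_comm u p.1).trans hpu
  have : minkowski n (unitGeodesic p u hpu huu s).1 (unitGeodesic p u hpu huu t).1 =
      Real.cosh |s - t| := by
    simp only [unitGeodesic, map_add, map_smul, LinearMap.add_apply,
      LinearMap.smul_apply, smul_eq_mul, p.2.1, hpu, hup, huu, Real.cosh_abs, Real.cosh_sub]
    ring
  rw [hdist, this, Real.arcosh_cosh (abs_nonneg _), one_mul]

theorem hasDerivAt_unitGeodesic (p : Hyperboloid n) (u : Ambient n)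
    (hpu : minkowski n p.1 u = 0) (huu : minkowski n u u = -1) :
    HasDerivAt (fun t => (unitGeodesic p u hpu huu t).1) u 0 := by
  have h := ((Real.hasDerivAt_cosh 0).smul_const p.1).add
    ((Real.hasDerivAt_sinh 0).smul_const u)
  simp only [Real.sinh_zero, Real.cosh_zero, zero_smul, one_smul, zero_add] at h
  exact h

/-- Write `x = a • p + τ` with `τ ∈ T`. Then `a` is the hyperbolic cosine of the distance, and `τ`
normalized is the initial direction of a geodesic from `p` to `x`; if `a = 1`, the constant curve
serves. -/
theorem mem_geodesicUnion_of_mem {p x : Hyperboloid n} {T : Submodule ℝ (Ambient n)}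
    (hT : T ≤ tangentSpace p) (hx : x.1 ∈ Submodule.span ℝ {p.1} ⊔ T) :
    x ∈ geodesicUnion p T := by
  obtain ⟨y, hy, τ, hτ, hxy⟩ := Submodule.mem_sup.1 hx
  obtain ⟨a, rfl⟩ := Submodule.mem_span_singleton.1 hy
  have hpτ : minkowski n p.1 τ = 0 := hT hτ
  have hτp := (minkowski_comm τ p.1).trans hpτ
  have hpp := p.2.1
  have ha : minkowski n p.1 x.1 = a := by
    rw [← hxy]
    simp [hpτ, hpp]
  have ha1 : 1 ≤ a := ha ▸ one_le_minkowski p x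
  have hττ : minkowski n τ τ = 1 - a ^ 2 := by
    have h := x.2.1
    rw [← hxy] at h
    simp only [map_add, map_smul, LinearMap.add_apply, LinearMap.smul_apply, smul_eq_mul,
      hpp, hpτ, hτp] at h
    linarith
  rcases ha1.eq_or_lt with rfl | ha1
  · have hpx : p = x := eq_of_minkowski_eq_one ha
    subst hpx
    refine ⟨fun _ => p, 0, ⟨0, le_rfl, fun s t => ?_⟩, rfl, hasDerivAt_const _ _,
      T.zero_mem, 0, rfl⟩
    simp [hdist, hpp]
  · have hs : Real.sinh (Real.arcosh a) ≠ 0 :=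
      (Real.sinh_pos_iff.2 (Real.arcosh_pos ha1)).ne'
    have hcosh := Real.cosh_arcosh ha1.le
    set s := Real.arcosh a
    have hpu : minkowski n p.1 ((Real.sinh s)⁻¹ • τ) = 0 := by simp [hpτ]
    have huu : minkowski n ((Real.sinh s)⁻¹ • τ) ((Real.sinh s)⁻¹ • τ) = -1 := by
      simp only [map_smul, LinearMap.smul_apply, smul_eq_mul, hττ]
      rw [← hcosh, Real.cosh_sq]
      field_simp
      ring
    refine ⟨unitGeodesic p _ hpu huu, _, isGeodesic_unitGeodesic p _ hpu huu, ?_,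
      hasDerivAt_unitGeodesic p _ hpu huu, T.smul_mem _ hτ, s, ?_⟩
    · exact Subtype.ext (by simp [unitGeodesic])
    · refine Subtype.ext ?_
      rw [← hxy]
      simp only [unitGeodesic, smul_smul, mul_inv_cancel₀ hs, one_smul, hcosh]

/-- A rooted geodesic submanifold is the intersection of the hyperboloid with a linear subspace. -/
theorem mem_geodesicUnion_iff {p x : Hyperboloid n} {T : Submodule ℝ (Ambient n)}
    (hT : T ≤ tangentSpace p) :
    x ∈ geodesicUnion p T ↔ x.1 ∈ Submodule.span ℝ {p.1} ⊔ T := by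
  refine ⟨?_, mem_geodesicUnion_of_mem hT⟩
  rintro ⟨γ, v, hγ, rfl, hv, hvT, t, rfl⟩
  exact hγ.mem_span_sup hv hvT t

theorem disjoint_span_tangentSpace (p : Hyperboloid n) :
    Disjoint (Submodule.span ℝ {p.1}) (tangentSpace p) := by
  rw [Submodule.disjoint_def]
  intro v hv hvT
  obtain ⟨a, rfl⟩ := Submodule.mem_span_singleton.1 hv
  have h : minkowski n p.1 (a • p.1) = 0 := hvT
  rw [map_smul, p.2.1, smul_eq_mul, mul_one] at h
  rw [h, zero_smul]

theorem finrank_span_sup {p : Hyperboloid n} {T : Submodule ℝ (Ambient n)}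
    (hT : T ≤ tangentSpace p) :
    Module.finrank ℝ ↥(Submodule.span ℝ {p.1} ⊔ T) = Module.finrank ℝ T + 1 := by
  have hp : p.1 ≠ 0 := by
    intro h
    have := p.2.2
    rw [h] at this
    simp at this
  have h := Submodule.finrank_sup_add_finrank_inf_eq (Submodule.span ℝ {p.1}) T
  rw [((disjoint_span_tangentSpace p).mono_right hT).eq_bot, finrank_bot,
    finrank_span_singleton hp] at h
  omega

theorem span_sup_inf_tangentSpace {p : Hyperboloid n} {W : Submodule ℝ (Ambient n)}
    (hp : p.1 ∈ W) : Submodule.span ℝ {p.1} ⊔ W ⊓ tangentSpace p = W := by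
  refine le_antisymm (sup_le ((Submodule.span_singleton_le_iff_mem _ _).2 hp) inf_le_left) ?_
  intro w hw
  refine Submodule.mem_sup.2 ⟨minkowski n p.1 w • p.1, Submodule.mem_span_singleton.2 ⟨_, rfl⟩,
    w - minkowski n p.1 w • p.1, ⟨W.sub_mem hw (W.smul_mem _ hp), ?_⟩, by abel⟩
  change minkowski n p.1 (w - minkowski n p.1 w • p.1) = 0
  rw [map_sub, map_smul, p.2.1, smul_eq_mul, mul_one, sub_self]

theorem exists_isRootedGeodesicSubmanifold_iff {ι : Type*} {r : ℕ} {p : Hyperboloid n}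
    {x : ι → Hyperboloid n} :
    (∃ S, IsRootedGeodesicSubmanifold r p S ∧ ∀ i, x i ∈ S) ↔
      ∃ W : Submodule ℝ (Ambient n), p.1 ∈ W ∧ Module.finrank ℝ W = r + 1 ∧ ∀ i, (x i).1 ∈ W := by
  constructor
  · rintro ⟨S, ⟨T, hT, hr, rfl⟩, hx⟩
    exact ⟨Submodule.span ℝ {p.1} ⊔ T, Submodule.mem_sup_left (Submodule.mem_span_singleton_self _),
      by rw [finrank_span_sup hT, hr], fun i => (mem_geodesicUnion_iff hT).1 (hx i)⟩
  · rintro ⟨W, hp, hr, hx⟩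
    have hT : W ⊓ tangentSpace p ≤ tangentSpace p := inf_le_right
    refine ⟨_, ⟨W ⊓ tangentSpace p, hT, ?_, rfl⟩, fun i => ?_⟩
    · have := finrank_span_sup hT
      rw [span_sup_inf_tangentSpace hp, hr] at this
      omega
    · rw [mem_geodesicUnion_iff hT, span_sup_inf_tangentSpace hp]
      exact hx i

/-! ### Orthogonal projection to a linear section -/

/-- A vector of `W` orthogonal to all of `W` is null and orthogonal to `p`, hence zero. -/
theorem isCompl_orthogonal {p : Hyperboloid n} {W : Submodule ℝ (Ambient n)} (hp : p.1 ∈ W) :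
    IsCompl W (LinearMap.BilinForm.orthogonal (minkowski n) W) := by
  have hrefl : LinearMap.BilinForm.IsRefl (minkowski n) := fun x y h =>
    (minkowski_comm y x).trans h
  rw [LinearMap.BilinForm.isCompl_orthogonal_iff_disjoint hrefl, Submodule.disjoint_def]
  intro v hv hv'
  exact (minkowski_self_nonpos (p := p) (hv' _ hp)).2 (hv' _ hv)

/-- Projecting to a linear section brings a point closer to every point of the section. -/
theorem exists_mem_hdist_le {p : Hyperboloid n} {W : Submodule ℝ (Ambient n)} (hp : p.1 ∈ W)
    (w : Hyperboloid n) :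
    ∃ z : Hyperboloid n, z.1 ∈ W ∧ ∀ x : Hyperboloid n, x.1 ∈ W → hdist x z ≤ hdist x w := by
  obtain ⟨a, ha, b, hb, hab⟩ := Submodule.mem_sup.1
    ((isCompl_orthogonal hp).sup_eq_top ▸ Submodule.mem_top : w.1 ∈ _)
  have hb' : ∀ y ∈ W, minkowski n y b = 0 := fun y hy => hb y hy
  have hwx : ∀ y ∈ W, minkowski n y w.1 = minkowski n y a := by
    intro y hy
    rw [← hab, map_add, hb' y hy, add_zero]
  -- The normal part `b` is orthogonal to `p`, so its square is nonpositive. Hence normalizing `a`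
  -- divides its products with points of `W` by `m ≥ 1`.
  have haa : 1 ≤ minkowski n a a := by
    have h := w.2.1
    rw [← hab] at h
    simp only [map_add, LinearMap.add_apply, hb' a ha, minkowski_comm b a] at h
    linarith [(minkowski_self_nonpos (hb' _ hp)).1]
  set m := √(minkowski n a a) with hm
  have hm1 : 1 ≤ m := Real.one_le_sqrt.2 haa
  have hmm : m ^ 2 = minkowski n a a := Real.sq_sqrt (by linarith)
  have hz : minkowski n (m⁻¹ • a) (m⁻¹ • a) = 1 := by
    simp only [map_smul, LinearMap.smul_apply, smul_eq_mul, ← hmm]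
    field_simp
  have hpa := one_le_minkowski p w
  rw [hwx _ hp] at hpa
  refine ⟨⟨m⁻¹ • a, hz, fst_pos_of_minkowski_pos (p := p) hz ?_⟩, W.smul_mem _ ha, ?_⟩
  · rw [map_smul, smul_eq_mul]
    positivity
  · intro x hx
    have hxw := one_le_minkowski x w
    rw [hdist_le_hdist_iff, hwx _ hx, map_smul, smul_eq_mul]
    rw [hwx _ hx] at hxw
    exact mul_le_of_le_one_left (by linarith) (inv_le_one_of_one_le₀ hm1)

/-! ### Existence of means -/

/-- The point of the hyperboloid above a vector of `ℝⁿ`. -/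
def lift (y : EuclideanSpace ℝ (Fin n)) : Hyperboloid n :=
  ⟨(√(1 + ‖y‖ ^ 2), y), by
    rw [minkowski_self, Real.sq_sqrt (by positivity)]
    ring, by positivity⟩

theorem lift_snd (w : Hyperboloid n) : lift w.1.2 = w := by
  refine Subtype.ext (Prod.ext ?_ rfl)
  change √(1 + ‖w.1.2‖ ^ 2) = w.1.1
  rw [← w.fst_sq, Real.sqrt_sq w.2.2.le]

theorem continuous_hdist_lift (x : Hyperboloid n) : Continuous fun y => hdist x (lift y) := by
  have h : Continuous fun y => minkowski n x.1 (lift y).1 := by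
    refine (continuous_minkowski x.1).comp ?_
    change Continuous fun y : EuclideanSpace ℝ (Fin n) => (√(1 + ‖y‖ ^ 2), y)
    fun_prop
  exact Real.continuousOn_arcosh.comp_continuous h fun y => one_le_minkowski x (lift y)

theorem tendsto_hdist_lift (x : Hyperboloid n) :
    Tendsto (fun y => hdist x (lift y)) (cocompact _) atTop := by
  have hx := sub_pos.2 x.norm_snd_lt_fst
  have h1 : Tendsto (fun y : EuclideanSpace ℝ (Fin n) => Real.log ((x.1.1 - ‖x.1.2‖) * ‖y‖))
      (cocompact _) atTop :=
    Real.tendsto_log_atTop.comp ((tendsto_norm_cocompact_atTop).const_mul_atTop hx)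
  refine tendsto_atTop_mono' _ ?_ h1
  filter_upwards [tendsto_norm_cocompact_atTop.eventually (eventually_gt_atTop (0 : ℝ))] with y hy
  have h2 : ‖y‖ ≤ √(1 + ‖y‖ ^ 2) := Real.le_sqrt_of_sq_le (by linarith)
  have h3 : (x.1.1 - ‖x.1.2‖) * ‖y‖ ≤ minkowski n x.1 (lift y).1 := by
    change _ ≤ x.1.1 * √(1 + ‖y‖ ^ 2) - inner ℝ x.1.2 y
    have := real_inner_le_norm x.1.2 y
    have := mul_le_mul_of_nonneg_left h2 x.2.2.le
    linarith
  have h4 := Real.sqrt_nonneg (minkowski n x.1 (lift y).1 ^ 2 - 1)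
  -- Here `arcosh t = log (t + √(t² - 1))` is bounded below by `log t`.
  exact Real.log_le_log (by positivity) (by linarith)

/-- `z` minimizes the sum of the costs `ψ` of the distances to the points `x i`. -/
def IsCostMean (ψ : ℝ → ℝ) {k : ℕ} (x : Fin k → Hyperboloid n) (z : Hyperboloid n) : Prop :=
  ∀ w : Hyperboloid n, ∑ i, ψ (hdist (x i) z) ≤ ∑ i, ψ (hdist (x i) w)

/-- A nonnegative, continuous, increasing and unbounded cost function of the distance. -/
structure IsCost (ψ : ℝ → ℝ) : Prop where
  nonneg : ∀ t, 0 ≤ ψ t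
  continuous : Continuous ψ
  monotoneOn : MonotoneOn ψ (Set.Ici 0)
  tendsto : Tendsto ψ atTop atTop

theorem isCost_sq : IsCost fun t => t ^ 2 where
  nonneg t := sq_nonneg t
  continuous := by fun_prop
  monotoneOn := fun _ hs _ _ hst => pow_le_pow_left₀ hs hst 2
  tendsto := tendsto_pow_atTop two_ne_zero

theorem isCost_sinh_sq : IsCost fun t => Real.sinh t ^ 2 where
  nonneg t := sq_nonneg _
  continuous := by fun_prop
  monotoneOn := fun _ hs _ _ hst =>
    pow_le_pow_left₀ (Real.sinh_nonneg_iff.2 hs) (Real.sinh_le_sinh.2 hst) 2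
  tendsto := by
    refine (tendsto_pow_atTop two_ne_zero).comp (tendsto_atTop_mono' _ ?_ tendsto_id)
    filter_upwards [eventually_ge_atTop 0] with t ht using Real.self_le_sinh_iff.2 ht

theorem IsCost.exists_isCostMean {ψ : ℝ → ℝ} (hψ : IsCost ψ) {k : ℕ}
    (x : Fin k → Hyperboloid n) : ∃ z, IsCostMean ψ x z := by
  rcases isEmpty_or_nonempty (Fin k) with _ | ⟨⟨j⟩⟩
  · exact ⟨origin n, fun w => by simp⟩
  · have hcont : Continuous fun y => ∑ i, ψ (hdist (x i) (lift y)) :=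
      continuous_finsetSum _ fun i _ => hψ.continuous.comp (continuous_hdist_lift (x i))
    have hlim : Tendsto (fun y => ∑ i, ψ (hdist (x i) (lift y))) (cocompact _) atTop :=
      tendsto_atTop_mono
        (fun y => Finset.single_le_sum (f := fun i => ψ (hdist (x i) (lift y)))
          (fun i _ => hψ.nonneg _) (Finset.mem_univ j))
        (hψ.tendsto.comp (tendsto_hdist_lift (x j)))
    obtain ⟨y, hy⟩ := hcont.exists_forall_le hlim
    exact ⟨lift y, fun w => lift_snd w ▸ hy w.1.2⟩

theorem IsCost.exists_isCostMean_mem {ψ : ℝ → ℝ} (hψ : IsCost ψ) {k : ℕ}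
    {x : Fin k → Hyperboloid n} {p : Hyperboloid n} {W : Submodule ℝ (Ambient n)} (hp : p.1 ∈ W)
    (hx : ∀ i, (x i).1 ∈ W) : ∃ z : Hyperboloid n, z.1 ∈ W ∧ IsCostMean ψ x z := by
  obtain ⟨w, hw⟩ := hψ.exists_isCostMean x
  obtain ⟨z, hz, hzw⟩ := exists_mem_hdist_le hp w
  exact ⟨z, hz, fun u => (Finset.sum_le_sum fun i _ => hψ.monotoneOn (hdist_nonneg _ _)
    (hdist_nonneg _ _) (hzw (x i) (hx i))).trans (hw u)⟩

/-! ### Symmetries -/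

/-- The linear map underlying the point reflection at the midpoint of `p` and `q`. -/
def swapLinear (p q : Hyperboloid n) : Ambient n →ₗ[ℝ] Ambient n :=
  (minkowski n (p.1 + q.1)).smulRight ((1 + minkowski n p.1 q.1)⁻¹ • (p.1 + q.1)) - LinearMap.id

theorem swapLinear_apply (p q : Hyperboloid n) (v : Ambient n) :
    swapLinear p q v =
      (minkowski n (p.1 + q.1) v * (1 + minkowski n p.1 q.1)⁻¹) • (p.1 + q.1) - v := by
  simp [swapLinear, smul_smul]

theorem minkowski_add_self (p q : Hyperboloid n) :
    minkowski n (p.1 + q.1) (p.1 + q.1) = 2 * (1 + minkowski n p.1 q.1) := by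
  simp only [map_add, LinearMap.add_apply, p.2.1, q.2.1, minkowski_comm q.1 p.1]
  ring

/-- With `u = p + q`, `minkowski_add_self` makes the map `v ↦ (2⟨u, v⟩ / ⟨u, u⟩) u - v`, which fixes
`u` and is `-1` on its complement. -/
theorem minkowski_swapLinear (p q : Hyperboloid n) (v w : Ambient n) :
    minkowski n (swapLinear p q v) (swapLinear p q w) = minkowski n v w := by
  have hm : (1 + minkowski n p.1 q.1) ≠ 0 := by linarith [one_le_minkowski p q]
  simp only [swapLinear_apply]
  have hu := minkowski_add_self p q
  generalize p.1 + q.1 = u at *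
  generalize 1 + minkowski n p.1 q.1 = m at *
  simp only [map_sub, map_smul, LinearMap.sub_apply, LinearMap.smul_apply, smul_eq_mul, hu,
    minkowski_comm v u]
  field_simp
  ring

theorem swapLinear_left (p q : Hyperboloid n) : swapLinear p q p.1 = q.1 := by
  have hm : (1 + minkowski n p.1 q.1) ≠ 0 := by linarith [one_le_minkowski p q]
  rw [swapLinear_apply, map_add, LinearMap.add_apply, p.2.1, minkowski_comm q.1 p.1,
    mul_inv_cancel₀ hm, one_smul, add_sub_cancel_left]

theorem swapLinear_swapLinear (p q : Hyperboloid n) (v : Ambient n) :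
    swapLinear p q (swapLinear p q v) = v := by
  have hm : (1 + minkowski n p.1 q.1) ≠ 0 := by linarith [one_le_minkowski p q]
  simp only [swapLinear_apply]
  have hu := minkowski_add_self p q
  generalize p.1 + q.1 = u at *
  generalize 1 + minkowski n p.1 q.1 = m at *
  simp only [map_sub, map_smul, smul_eq_mul, hu, sub_sub_eq_add_sub]
  rw [add_sub_right_comm, ← sub_smul, add_eq_right]
  convert zero_smul ℝ u using 2
  field_simp
  ring

/-- The point reflection of hyperbolic space at the midpoint of `p` and `q`. -/
def swap (p q x : Hyperboloid n) : Hyperboloid n :=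
  have h : minkowski n (swapLinear p q x.1) (swapLinear p q x.1) = 1 := by
    rw [minkowski_swapLinear, x.2.1]
  ⟨swapLinear p q x.1, h, fst_pos_of_minkowski_pos (p := q) h (by
    rw [← swapLinear_left p q, minkowski_swapLinear]
    exact zero_lt_one.trans_le (one_le_minkowski p x))⟩

theorem hdist_swap (p q x y : Hyperboloid n) : hdist (swap p q x) (swap p q y) = hdist x y := by
  simp only [hdist, swap, minkowski_swapLinear]

theorem swap_left (p q : Hyperboloid n) : swap p q p = q := Subtype.ext (swapLinear_left p q)

theorem swap_swap (p q x : Hyperboloid n) : swap p q (swap p q x) = x :=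
  Subtype.ext (swapLinear_swapLinear p q x.1)

theorem IsCostMean.swap {ψ : ℝ → ℝ} {k : ℕ} {x : Fin k → Hyperboloid n} {z : Hyperboloid n}
    (h : IsCostMean ψ x z) (p q : Hyperboloid n) :
    IsCostMean ψ (fun i => swap p q (x i)) (HypEmbed.swap p q z) := by
  intro w
  have := h (HypEmbed.swap p q w)
  rw [← swap_swap p q w]
  simpa only [hdist_swap] using this

theorem finrank_map_swapLinear (p q : Hyperboloid n) (W : Submodule ℝ (Ambient n)) :
    Module.finrank ℝ (W.map (swapLinear p q)) = Module.finrank ℝ W :=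
  LinearEquiv.finrank_eq (Submodule.equivMapOfInjective _
    (Function.LeftInverse.injective (swapLinear_swapLinear p q)) W).symm

/-! ### Embeddings rooted at a mean -/

/-- The distances `d i j` are realized by points of a dimension-`r` geodesic submanifold that is
rooted at `p`, where `p` minimizes the total cost `ψ` of the distances to these points. -/
def EmbedsAtCostMean (ψ : ℝ → ℝ) {k : ℕ} (d : Fin k → Fin k → ℝ) (r : ℕ)
    (p : Hyperboloid n) : Prop :=
  ∃ (x : Fin k → Hyperboloid n) (S : Set (Hyperboloid n)),
    (∀ i j, hdist (x i) (x j) = d i j) ∧ IsRootedGeodesicSubmanifold r p S ∧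
      (∀ i, x i ∈ S) ∧ IsCostMean ψ x p

theorem embedsAtCostMean_iff {ψ : ℝ → ℝ} {k : ℕ} {d : Fin k → Fin k → ℝ} {r : ℕ}
    {p : Hyperboloid n} :
    EmbedsAtCostMean ψ d r p ↔ ∃ (x : Fin k → Hyperboloid n) (W : Submodule ℝ (Ambient n)),
      (∀ i j, hdist (x i) (x j) = d i j) ∧ p.1 ∈ W ∧ Module.finrank ℝ W = r + 1 ∧
        (∀ i, (x i).1 ∈ W) ∧ IsCostMean ψ x p := by
  constructor
  · rintro ⟨x, S, hd, hS, hx, hm⟩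
    obtain ⟨W, hp, hr, hW⟩ := exists_isRootedGeodesicSubmanifold_iff.1 ⟨S, hS, hx⟩
    exact ⟨x, W, hd, hp, hr, hW, hm⟩
  · rintro ⟨x, W, hd, hp, hr, hW, hm⟩
    obtain ⟨S, hS, hx⟩ := exists_isRootedGeodesicSubmanifold_iff.2 ⟨W, hp, hr, hW⟩
    exact ⟨x, S, hd, hS, hx, hm⟩

/-- Whether distances embed in a geodesic submanifold rooted at a mean depends neither on the cost
function nor on the prescribed position of the mean. -/
theorem EmbedsAtCostMean.of_isCost {φ ψ : ℝ → ℝ} (hψ : IsCost ψ) {k : ℕ}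
    {d : Fin k → Fin k → ℝ} {r : ℕ} {p : Hyperboloid n} (h : EmbedsAtCostMean φ d r p)
    (q : Hyperboloid n) : EmbedsAtCostMean ψ d r q := by
  obtain ⟨x, W, hd, hp, hr, hx, -⟩ := embedsAtCostMean_iff.1 h
  obtain ⟨z, hz, hm⟩ := hψ.exists_isCostMean_mem hp hx
  refine embedsAtCostMean_iff.2 ⟨fun i => swap z q (x i), W.map (swapLinear z q),
    fun i j => by rw [hdist_swap, hd], ?_, by rw [finrank_map_swapLinear, hr],
    fun i => Submodule.mem_map_of_mem (hx i), ?_⟩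
  · rw [← swapLinear_left z q]
    exact Submodule.mem_map_of_mem hz
  · have := hm.swap z q
    rwa [swap_left] at this

theorem embedsAtPseudoEuclideanMean_iff_embedsAtKarcherMean {k : ℕ} {d : Fin k → Fin k → ℝ}
    {r : ℕ} (p q : Hyperboloid n) :
    EmbedsAtPseudoEuclideanMean d r p ↔ EmbedsAtKarcherMean d r q :=
  ⟨fun h => EmbedsAtCostMean.of_isCost (φ := fun t => Real.sinh t ^ 2) isCost_sq h q,
    fun h => EmbedsAtCostMean.of_isCost (φ := fun t => t ^ 2) isCost_sinh_sq h p⟩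

end HypEmbed

end

theorem mainTheorem6 (n k r : ℕ) (d : Fin k → Fin k → ℝ) :
    ((∃ p : HypEmbed.Hyperboloid n, HypEmbed.EmbedsAtPseudoEuclideanMean d r p) ↔
      (∃ q : HypEmbed.Hyperboloid n, HypEmbed.EmbedsAtKarcherMean d r q)) ∧
    (HypEmbed.EmbedsAtPseudoEuclideanMean d r (HypEmbed.origin n) ↔
      HypEmbed.EmbedsAtKarcherMean d r (HypEmbed.origin n)) :=
  -- By homogeneity the equivalence holds at every prescribed root, so the existential version
  -- follows pointwise.
  ⟨exists_congr fun p => HypEmbed.embedsAtPseudoEuclideanMean_iff_embedsAtKarcherMean p p,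
    HypEmbed.embedsAtPseudoEuclideanMean_iff_embedsAtKarcherMean _ _⟩
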